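/- Let $d\ge 1$ be an integer and let $Q=[0,1)^d\subset\mathbb{R}^d$ be the half-open unit cube. For $t\in\mathbb{R}^d$ let $e_t(x)=\exp(2\pi i\, t\cdot x)$, where $t\cdot x=t_1x_1+\cdots+t_dx_d$. Let $T$ be a subset of $\mathbb{R}^d$. Then the family of exponentials $(e_t)_{t\in T}$ is an orthonormal basis of the complex Hilbert space $L^2(Q)$ (with respect to Lebesgue measure, with inner product $\langle f,g\rangle=\int_Q f\,\overline{g}$) if and only if the translates $Q+t$, $t\in T$, tile $\mathbb{R}^d$, that is, every $x\in\mathbb{R}^d$ can be written uniquely as $x=q+t$ with $q\in Q$ and $t\in T$. -/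

import Mathlib

open MeasureTheory

noncomputable section

/-- The half-open unit cube `[0,1)^d` in `d`-dimensional Euclidean space. -/
def unitCube (d : ℕ) : Set (EuclideanSpace ℝ (Fin d)) :=
  {x | ∀ j, 0 ≤ x j ∧ x j < 1}

/-- The exponential `e_t(x) = exp(2πi t·x)`, where `t·x = t_1 x_1 + ⋯ + t_d x_d`. -/
def expFun {d : ℕ} (t x : EuclideanSpace ℝ (Fin d)) : ℂ :=
  Complex.exp (2 * Real.pi * Complex.I * ((∑ j, t j * x j : ℝ) : ℂ))

/-- `T` is a tiling set for the unit cube: each point of `ℝ^d` can be written uniquely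
as `q + t` with `q` in the unit cube and `t ∈ T`. -/
def IsTilingSet {d : ℕ} (T : Set (EuclideanSpace ℝ (Fin d))) : Prop :=
  ∀ x : EuclideanSpace ℝ (Fin d),
    ∃! p : EuclideanSpace ℝ (Fin d) × EuclideanSpace ℝ (Fin d),
      p.1 ∈ unitCube d ∧ p.2 ∈ T ∧ x = p.1 + p.2

/-- `T` is a spectrum for the unit cube: the family of (the `L²`-classes of) the exponentials
`e_t`, `t ∈ T`, is an orthonormal basis (Hilbert basis) of the complex Hilbert space
`L²([0,1)^d)` with respect to Lebesgue measure. -/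
def IsSpectrum {d : ℕ} (T : Set (EuclideanSpace ℝ (Fin d))) : Prop :=
  ∃ b : HilbertBasis T ℂ (Lp ℂ 2 (volume.restrict (unitCube d))),
    ∀ t : T, (b t : EuclideanSpace ℝ (Fin d) → ℂ)
      =ᵐ[volume.restrict (unitCube d)] expFun (t : EuclideanSpace ℝ (Fin d))

end

/-
Let `F` be the squared modulus of the Fourier transform of the indicator `𝟙_Q`; both `𝟙_Q` and, by
Plancherel, `F` have integral `1`. If two nonnegative functions `f` and `g` have the same finite
nonzero integral, then `∑ f(x - t) = 1` and `∑ g(x - t) ≤ 1` almost everywhere force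
`∑ g(x - t) = 1` almost everywhere, because the convolution of `f` with the defect
`1 - ∑ g(· - t)` vanishes.

The exponentials are orthonormal exactly when distinct points of `T` differ by a nonzero integer in
some coordinate. Then the cubes are disjoint, so `∑ 𝟙_Q(x - t) ≤ 1`, and Bessel's inequality for
`e_x` gives `∑ F(x - t) ≤ 1`. For a spectrum the second sum is `1` by Parseval, hence so is the
first. For a tiling the separation is Keller's theorem and the first sum is `1`, hence so is the
second: almost every `e_x` lies in the closed span of the `e_t`, which by Plancherel is all of `L²`.
-/

open FourierTransform
open scoped ComplexConjugate ENNReal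

section Keller

/-- The half-open unit cube in `ℝ^J` with least vertex `a`. -/
def cube {J : Type*} (a : J → ℝ) : Set (J → ℝ) := {x | ∀ j, x j ∈ Set.Ico (a j) (a j + 1)}

/-- The unit cubes with least vertices `τ i` tile `ℝ^J`. They are indexed, rather than given by
their set of vertices, because Keller's argument moves some of them and compares the two tilings. -/
def IsCubeTiling {J ι : Type*} (τ : ι → J → ℝ) : Prop :=
  ∀ x : J → ℝ, ∃! i, x ∈ cube (τ i)

variable {J ι : Type*}

theorem fract_eq_of_existsUnique_mem_Ico {a : ι → ℝ}
    (h : ∀ x : ℝ, ∃! i, x ∈ Set.Ico (a i) (a i + 1)) (i j : ι) :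
    Int.fract (a i) = Int.fract (a j) := by
  have exists_add_one (i : ι) : ∃ k, a k = a i + 1 := by
    obtain ⟨k, hk, -⟩ := h (a i + 1)
    refine ⟨k, hk.1.antisymm (not_lt.mp fun hlt ↦ ?_)⟩
    have hik : i = k := (h (a k)).unique ⟨by linarith [hk.2], hlt⟩ ⟨le_rfl, by linarith⟩
    exact lt_irrefl _ (hik ▸ hk.2)
  have exists_add_nat (i : ι) (n : ℕ) : ∃ k, a k = a i + n := by
    induction n with
    | zero => exact ⟨i, by simp⟩
    | succ n ih =>
      obtain ⟨k, hk⟩ := ih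
      obtain ⟨l, hl⟩ := exists_add_one k
      exact ⟨l, by rw [hl, hk]; push_cast; ring⟩
  wlog hij : a i ≤ a j generalizing i j
  · exact (this j i (le_of_not_ge hij)).symm
  obtain ⟨k, hk⟩ := exists_add_nat i ⌊a j - a i⌋₊
  have hjk : j = k := (h (a j)).unique ⟨le_rfl, by linarith⟩
    ⟨by linarith [Nat.floor_le (sub_nonneg.mpr hij)],
      by linarith [Nat.lt_floor_add_one (a j - a i)]⟩
  rw [hjk, hk, Int.fract_add_natCast]

theorem mem_cube_add_iff {a b x : J → ℝ} : x ∈ cube (a + b) ↔ x - b ∈ cube a :=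
  forall_congr' fun j ↦ by
    simp only [Pi.add_apply, Pi.sub_apply, add_right_comm, Set.mem_Ico, le_sub_iff_add_le,
      sub_lt_iff_lt_add]

namespace IsCubeTiling

variable {τ : ι → J → ℝ}

theorem fract_eq_of_update_mem [DecidableEq J] (h : IsCubeTiling τ) {x : J → ℝ} {k : J}
    {u v : ℝ} {p q : ι}
    (hp : Function.update x k u ∈ cube (τ p)) (hq : Function.update x k v ∈ cube (τ q)) :
    Int.fract (τ p k) = Int.fract (τ q k) := by
  have mem_iff (i : ι) (w : ℝ) : Function.update x k w ∈ cube (τ i) ↔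
      w ∈ Set.Ico (τ i k) (τ i k + 1) ∧ ∀ j ≠ k, x j ∈ Set.Ico (τ i j) (τ i j + 1) :=
    Function.forall_update_iff x fun j y ↦ y ∈ Set.Ico (τ i j) (τ i j + 1)
  let line := {i // ∀ j ≠ k, x j ∈ Set.Ico (τ i j) (τ i j + 1)}
  refine fract_eq_of_existsUnique_mem_Ico (a := fun i : line ↦ τ i k) (fun w ↦ ?_)
    ⟨p, ((mem_iff p u).mp hp).2⟩ ⟨q, ((mem_iff q v).mp hq).2⟩
  obtain ⟨i, hi, hi_unique⟩ := h (Function.update x k w)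
  exact ⟨⟨i, ((mem_iff i w).mp hi).2⟩, ((mem_iff i w).mp hi).1,
    fun j hj ↦ Subtype.ext (hi_unique j ((mem_iff j w).mpr ⟨hj, j.2⟩))⟩

theorem shift [DecidableEq J] (h : IsCubeTiling τ) (k : J) (c s : ℝ) :
    IsCubeTiling fun i ↦ if Int.fract (τ i k) = c then τ i + Pi.single k s else τ i := by
  intro x
  obtain ⟨p, hp, hp_unique⟩ := h x
  obtain ⟨q, hq, hq_unique⟩ := h (x - Pi.single k s)
  have hpq : Int.fract (τ p k) = Int.fract (τ q k) := by
    refine h.fract_eq_of_update_mem (x := x) (u := x k) (v := x k - s) (by simpa using hp) ?_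
    convert hq using 1
    ext j
    obtain rfl | hj := eq_or_ne j k <;> simp [*]
  by_cases hc : Int.fract (τ q k) = c
  · refine ⟨q, by simpa only [hc, if_true, mem_cube_add_iff] using hq, fun i hi ↦ ?_⟩
    beta_reduce at hi
    split_ifs at hi with hic
    · exact hq_unique i (mem_cube_add_iff.mp hi)
    · exact absurd (hp_unique i hi ▸ hpq.trans hc) hic
  · refine ⟨p, by simpa only [hpq, hc, if_false] using hp, fun i hi ↦ ?_⟩
    beta_reduce at hi
    split_ifs at hi with hic
    · exact absurd (hq_unique i (mem_cube_add_iff.mp hi) ▸ hic) hc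
    · exact hp_unique i hi

theorem exists_sub_eq_int [Finite J] (h : IsCubeTiling τ) {p q : ι} (hpq : p ≠ q) :
    ∃ j, ∃ n : ℤ, n ≠ 0 ∧ τ p j - τ q j = n := by
  classical
  induction hm : {j | τ p j ≠ τ q j}.ncard using Nat.strong_induction_on generalizing τ with
  | _ m ih =>
  obtain ⟨k, hk⟩ : ∃ k, τ p k ≠ τ q k := by
    by_contra! heq
    refine hpq ((h (τ p)).unique (fun j ↦ ?_) fun j ↦ ?_) <;> simp [heq]
  by_cases hfract : Int.fract (τ p k) = Int.fract (τ q k)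
  · obtain ⟨n, hn⟩ := Int.fract_eq_fract.mp hfract
    exact ⟨k, n, by rintro rfl; exact hk (by simpa [sub_eq_zero] using hn), hn⟩
  · -- Moving the cubes in the class of `p` by `τ q k - τ p k` makes `p` and `q` agree at `k`.
    set σ : ι → J → ℝ := fun i ↦
      if Int.fract (τ i k) = Int.fract (τ p k) then τ i + Pi.single k (τ q k - τ p k) else τ i
    have hσp : σ p = Function.update (τ p) k (τ q k) := by
      ext j
      obtain rfl | hj := eq_or_ne j k <;> simp [σ, *]
    have hσq : σ q = τ q := if_neg (Ne.symm hfract)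
    have hdiff : {j | σ p j ≠ σ q j} ⊂ {j | τ p j ≠ τ q j} := by
      refine (Set.ssubset_iff_of_subset fun j hj ↦ ?_).mpr ⟨k, hk, by simp [hσp, hσq]⟩
      obtain rfl | hjk := eq_or_ne j k
      · exact hk
      · simpa [hσp, hσq, hjk] using hj
    have hσ : IsCubeTiling σ := h.shift k _ _
    obtain ⟨j, n, hn, hjn⟩ := ih _ (hm ▸ Set.ncard_lt_ncard hdiff) hσ rfl
    rw [hσp, hσq] at hjn
    have hjk : j ≠ k := by
      rintro rfl
      exact hn (by simpa using hjn.symm)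
    exact ⟨j, n, hn, by rwa [Function.update_of_ne hjk] at hjn⟩

end IsCubeTiling

end Keller

section Exchange

variable {G ι : Type*} [AddCommGroup G] [MeasurableSpace G] [MeasurableAdd₂ G] [MeasurableNeg G]
  {μ : Measure G} [μ.IsAddLeftInvariant] [μ.IsNegInvariant] [Countable ι]
  {τ : ι → G} {f g : G → ℝ≥0∞}

theorem lintegral_mul_tsum_sub_comm (hf : Measurable f) (hg : Measurable g) (y : G) :
    ∫⁻ x, f x * ∑' i, g (y - x - τ i) ∂μ = ∫⁻ x, g x * ∑' i, f (y - x - τ i) ∂μ := by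
  have hcomm (i : ι) : ∫⁻ x, f x * g (y - x - τ i) ∂μ = ∫⁻ x, g x * f (y - x - τ i) ∂μ := by
    rw [← lintegral_sub_left_eq_self (fun x ↦ f x * g (y - x - τ i)) (y - τ i)]
    exact lintegral_congr fun x ↦ by
      rw [mul_comm, sub_right_comm y _ (τ i), sub_sub_cancel, sub_right_comm y x]
  simp_rw [← ENNReal.tsum_mul_left]
  rw [lintegral_tsum fun i ↦ by fun_prop, lintegral_tsum fun i ↦ by fun_prop]
  exact tsum_congr hcomm

theorem tsum_sub_ae_eq_one_of_lintegral_eq [SFinite μ]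
    (hf : Measurable f) (hg : Measurable g) (hfg : ∫⁻ x, f x ∂μ = ∫⁻ x, g x ∂μ)
    (hf_zero : ∫⁻ x, f x ∂μ ≠ 0) (hf_top : ∫⁻ x, f x ∂μ ≠ ∞)
    (hf_one : ∀ᵐ x ∂μ, ∑' i, f (x - τ i) = 1) (hg_one : ∀ᵐ x ∂μ, ∑' i, g (x - τ i) ≤ 1) :
    ∀ᵐ x ∂μ, ∑' i, g (x - τ i) = 1 := by
  set D : G → ℝ≥0∞ := fun x ↦ 1 - ∑' i, g (x - τ i)
  have hD_meas : Measurable D := by fun_prop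
  have hfD (y : G) : ∫⁻ x, f x * D (y - x) ∂μ = 0 := by
    have hsplit : ∀ᵐ x ∂μ, f x * D (y - x) + f x * ∑' i, g (y - x - τ i) = f x := by
      filter_upwards [(quasiMeasurePreserving_sub_left μ y).ae hg_one] with x hx
      rw [← mul_add, tsub_add_cancel_of_le hx, mul_one]
    have hsum : ∫⁻ x, f x * ∑' i, g (y - x - τ i) ∂μ = ∫⁻ x, f x ∂μ := by
      rw [lintegral_mul_tsum_sub_comm hf hg, hfg]
      refine lintegral_congr_ae ?_
      filter_upwards [(quasiMeasurePreserving_sub_left μ y).ae hf_one] with x hx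
      rw [hx, mul_one]
    have htotal := lintegral_congr_ae hsplit
    rw [lintegral_add_left (by fun_prop), hsum] at htotal
    exact ENNReal.add_right_inj hf_top |>.mp (by rw [add_comm, htotal, add_zero])
  have hDint : ∫⁻ y, D y ∂μ = 0 := by
    have hprod : (∫⁻ x, f x ∂μ) * ∫⁻ y, D y ∂μ = 0 :=
      calc (∫⁻ x, f x ∂μ) * ∫⁻ y, D y ∂μ
          = ∫⁻ x, ∫⁻ y, f x * D (y - x) ∂μ ∂μ := by
            rw [← lintegral_mul_const _ hf]
            refine lintegral_congr fun x ↦ ?_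
            rw [lintegral_const_mul _ (by fun_prop), lintegral_sub_right_eq_self D x]
        _ = ∫⁻ y, ∫⁻ x, f x * D (y - x) ∂μ ∂μ := lintegral_lintegral_swap (by fun_prop)
        _ = 0 := by simp [hfD]
    exact (mul_eq_zero.mp hprod).resolve_left hf_zero
  filter_upwards [(lintegral_eq_zero_iff hD_meas).mp hDint, hg_one] with x hx hx_le
  exact hx_le.antisymm (tsub_eq_zero_iff_le.mp hx)

end Exchange

theorem enorm_Lp_two_sq {α F : Type*} [MeasurableSpace α] [NormedAddCommGroup F] {μ : Measure α}
    (f : Lp F 2 μ) : ‖f‖ₑ ^ 2 = ∫⁻ x, ‖f x‖ₑ ^ 2 ∂μ := by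
  simpa [Lp.enorm_def] using eLpNorm_nnreal_pow_eq_lintegral (p := 2) (f := f) (μ := μ) two_ne_zero

section Plancherel

variable {E F : Type*} [NormedAddCommGroup E] [InnerProductSpace ℝ E] [FiniteDimensional ℝ E]
  [MeasurableSpace E] [BorelSpace E] [NormedAddCommGroup F]

theorem continuous_fourier [NormedSpace ℂ F] {f : E → F} (hf : Integrable f) : Continuous (𝓕 f) :=
  VectorFourier.fourierIntegral_continuous Real.continuous_fourierChar continuous_inner hf

variable [InnerProductSpace ℂ F] [CompleteSpace F] {f : E → F}

theorem fourier_toLp_ae_eq (hf : Integrable f) (hf2 : MemLp f 2) :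
    (𝓕 (hf2.toLp f) : Lp F 2 (volume : Measure E)) =ᵐ[volume] 𝓕 f := by
  refine ae_eq_of_integral_contDiff_smul_eq ((Lp.memLp _).locallyIntegrable one_le_two)
    (continuous_fourier hf).locallyIntegrable fun g hg hg_supp ↦ ?_
  have hgc_supp : HasCompactSupport (Complex.ofRealCLM ∘ g) := hg_supp.comp_left rfl
  set φ : SchwartzMap E ℂ := hgc_supp.toSchwartzMap (Complex.ofRealCLM.contDiff.comp hg) with hφ
  have hφ_smul (v : E) (z : F) : g v • z = φ v • z := by simp [hφ]
  simp_rw [hφ_smul]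
  calc ∫ w, φ w • (𝓕 (hf2.toLp f) : Lp F 2 (volume : Measure E)) w
      = ∫ v, 𝓕 φ v • hf2.toLp f v := by
        rw [← Lp.toTemperedDistribution_apply, ← Lp.fourier_toTemperedDistribution_eq,
          TemperedDistribution.fourier_apply, Lp.toTemperedDistribution_apply]
    _ = ∫ v, 𝓕 (φ : E → ℂ) v • f v := by
        refine integral_congr_ae ?_
        filter_upwards [hf2.coeFn_toLp] with v hv
        rw [hv, SchwartzMap.fourier_coe]
    _ = ∫ w, φ w • 𝓕 f w := by
        simpa using! VectorFourier.integral_fourierIntegral_smul_eq_flip (L := innerₗ E)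
          Real.continuous_fourierChar continuous_inner φ.integrable hf

theorem lintegral_enorm_fourier_sq (hf : Integrable f) (hf2 : MemLp f 2) :
    ∫⁻ w, ‖𝓕 f w‖ₑ ^ 2 = ∫⁻ v, ‖f v‖ₑ ^ 2 := by
  calc ∫⁻ w, ‖𝓕 f w‖ₑ ^ 2
      = ‖(𝓕 (hf2.toLp f) : Lp F 2 (volume : Measure E))‖ₑ ^ 2 := by
        rw [enorm_Lp_two_sq]
        exact lintegral_congr_ae ((fourier_toLp_ae_eq hf hf2).symm.fun_comp fun z ↦ ‖z‖ₑ ^ 2)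
    _ = ‖hf2.toLp f‖ₑ ^ 2 := by
        rw [← ofReal_norm, Lp.norm_fourier_eq, ofReal_norm]
    _ = ∫⁻ v, ‖f v‖ₑ ^ 2 := by
        rw [enorm_Lp_two_sq]
        exact lintegral_congr_ae (hf2.coeFn_toLp.fun_comp fun z ↦ ‖z‖ₑ ^ 2)

end Plancherel

section Hilbert

variable {𝕜 H ι : Type*} [RCLike 𝕜] [NormedAddCommGroup H] [InnerProductSpace 𝕜 H] {v : ι → H}

theorem tsum_enorm_inner_sq_le (hv : Orthonormal 𝕜 v) (x : H) :
    ∑' i, ‖inner 𝕜 (v i) x‖ₑ ^ 2 ≤ ‖x‖ₑ ^ 2 := by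
  refine ENNReal.summable.tsum_le_of_sum_le fun s ↦ ?_
  have := ENNReal.ofReal_le_ofReal (hv.sum_inner_products_le x (s := s))
  rw [ENNReal.ofReal_sum_of_nonneg fun _ _ ↦ by positivity] at this
  simpa only [ENNReal.ofReal_pow (norm_nonneg _), ofReal_norm] using this

theorem tsum_enorm_inner_sq_eq (b : HilbertBasis ι 𝕜 H) (x : H) :
    ∑' i, ‖inner 𝕜 (b i) x‖ₑ ^ 2 = ‖x‖ₑ ^ 2 := by
  have hsum : HasSum (fun i ↦ ‖inner 𝕜 (b i) x‖ ^ 2) (‖x‖ ^ 2) := by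
    rw [← RCLike.hasSum_ofReal (𝕜 := 𝕜)]
    convert b.hasSum_inner_mul_inner x x using 2
    · rw [← inner_conj_symm x, RCLike.conj_mul]; push_cast; rfl
    · rw [inner_self_eq_norm_sq_to_K]; push_cast; rfl
  have := congrArg ENNReal.ofReal hsum.tsum_eq
  rw [ENNReal.ofReal_tsum_of_nonneg (fun _ ↦ by positivity) hsum.summable] at this
  simpa only [ENNReal.ofReal_pow (norm_nonneg _), ofReal_norm] using this

theorem inner_eq_zero_of_tsum_enorm_inner_sq_eq (hv : Orthonormal 𝕜 v) {x f : H}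
    (hx : ∑' i, ‖inner 𝕜 (v i) x‖ₑ ^ 2 = ‖x‖ₑ ^ 2) (hf : ∀ i, inner 𝕜 (v i) f = 0) :
    inner 𝕜 x f = 0 := by
  set K := Submodule.span 𝕜 {f}
  have hv_mem (i : ι) : v i ∈ Kᗮ :=
    Submodule.mem_orthogonal_singleton_iff_inner_left.mpr (hf i)
  have hle : ‖x‖ₑ ^ 2 ≤ ‖Kᗮ.starProjection x‖ₑ ^ 2 :=
    calc ‖x‖ₑ ^ 2 = ∑' i, ‖inner 𝕜 (v i) (Kᗮ.starProjection x)‖ₑ ^ 2 := by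
          rw [← hx]
          refine tsum_congr fun i ↦ ?_
          rw [← Submodule.inner_starProjection_left_eq_right,
            Submodule.starProjection_eq_self_iff.mpr (hv_mem i)]
      _ ≤ _ := tsum_enorm_inner_sq_le hv _
  have hx_mem : x ∈ Kᗮ := (Kᗮ.mem_iff_norm_starProjection x).mpr <|
    (Kᗮ.norm_starProjection_apply_le x).antisymm
      (enorm_le_iff_norm_le.mp ((ENNReal.pow_le_pow_left_iff two_ne_zero).mp hle))
  exact Submodule.mem_orthogonal_singleton_iff_inner_left.mp hx_mem

end Hilbert

section Separation

variable {d : ℕ} {T : Set (EuclideanSpace ℝ (Fin d))}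

/-- The translate `Q + t` of the half-open unit cube `Q`. -/
def unitCubeAt (t : EuclideanSpace ℝ (Fin d)) : Set (EuclideanSpace ℝ (Fin d)) :=
  {x | x - t ∈ unitCube d}

/-- Any two distinct points of `T` differ by a nonzero integer in some coordinate. This is the
common combinatorial content of the two sides of the theorem: it holds for tilings by Keller's
theorem, and it says exactly that the exponentials are orthonormal. -/
def IsIntSeparated (T : Set (EuclideanSpace ℝ (Fin d))) : Prop :=
  T.Pairwise fun s t ↦ ∃ j, ∃ n : ℤ, n ≠ 0 ∧ s j - t j = n

theorem mem_unitCubeAt_iff {x t : EuclideanSpace ℝ (Fin d)} :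
    x ∈ unitCubeAt t ↔ ∀ j, t j ≤ x j ∧ x j < t j + 1 :=
  forall_congr' fun j ↦ by rw [PiLp.sub_apply, sub_nonneg, sub_lt_iff_lt_add']

theorem isTilingSet_iff :
    IsTilingSet T ↔ ∀ x : EuclideanSpace ℝ (Fin d), ∃! t : T, x ∈ unitCubeAt t.1 := by
  refine forall_congr' fun x ↦ ⟨?_, ?_⟩
  · rintro ⟨⟨q, t⟩, ⟨hq, ht, rfl⟩, h_unique⟩
    refine ⟨⟨t, ht⟩, by simpa [unitCubeAt] using hq, fun s hs ↦ Subtype.ext ?_⟩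
    exact congrArg Prod.snd (h_unique (q + t - s, s) ⟨hs, s.2, by simp⟩)
  · rintro ⟨t, ht, h_unique⟩
    refine ⟨(x - t, t), ⟨ht, t.2, by simp⟩, ?_⟩
    rintro ⟨q, s⟩ ⟨hq, hs, rfl⟩
    obtain rfl := h_unique ⟨s, hs⟩ (by simpa [unitCubeAt] using hq)
    simp

theorem IsTilingSet.isIntSeparated (h : IsTilingSet T) : IsIntSeparated T := by
  have hτ : IsCubeTiling fun t : T ↦ WithLp.ofLp t.1 := fun x ↦ by
    simpa only [mem_unitCubeAt_iff] using! isTilingSet_iff.mp h (WithLp.toLp 2 x)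
  intro s hs t ht hst
  exact hτ.exists_sub_eq_int (p := ⟨s, hs⟩) (q := ⟨t, ht⟩) (by simpa using hst)

namespace IsIntSeparated

theorem exists_one_le_abs_sub (h : IsIntSeparated T) {s t : T} (hst : s ≠ t) :
    ∃ j, 1 ≤ |s.1 j - t.1 j| := by
  obtain ⟨j, n, hn, hj⟩ := h s.2 t.2 (Subtype.coe_ne_coe.mpr hst)
  exact ⟨j, by rw [hj, ← Int.cast_abs, ← Int.cast_one, Int.cast_le]; exact Int.one_le_abs hn⟩

theorem eq_of_mem_unitCubeAt (h : IsIntSeparated T) {x : EuclideanSpace ℝ (Fin d)} {s t : T}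
    (hs : x ∈ unitCubeAt s.1) (ht : x ∈ unitCubeAt t.1) : s = t := by
  by_contra hst
  obtain ⟨j, hj⟩ := h.exists_one_le_abs_sub hst
  have hsj := mem_unitCubeAt_iff.mp hs j
  have htj := mem_unitCubeAt_iff.mp ht j
  exact hj.not_gt (abs_lt.mpr ⟨by linarith, by linarith⟩)

theorem tsum_indicator_unitCube (h : IsIntSeparated T) (x : EuclideanSpace ℝ (Fin d)) :
    ∑' t : T, (unitCube d).indicator (1 : EuclideanSpace ℝ (Fin d) → ℝ≥0∞) (x - t) =
      (⋃ t : T, unitCubeAt t.1).indicator 1 x := by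
  change ∑' t : T, (unitCubeAt t.1).indicator (1 : EuclideanSpace ℝ (Fin d) → ℝ≥0∞) x = _
  by_cases hx : x ∈ ⋃ t : T, unitCubeAt t.1
  · obtain ⟨t, ht⟩ := Set.mem_iUnion.mp hx
    rw [tsum_eq_single t fun s hs ↦
      Set.indicator_of_notMem (fun hxs ↦ hs (h.eq_of_mem_unitCubeAt hxs ht)) _,
      Set.indicator_of_mem ht, Set.indicator_of_mem hx]
  · rw [Set.indicator_of_notMem hx, ENNReal.tsum_eq_zero]
    exact fun t ↦ Set.indicator_of_notMem (fun ht ↦ hx (Set.mem_iUnion_of_mem t ht)) _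

theorem locallyFinite_unitCubeAt (h : IsIntSeparated T) :
    LocallyFinite fun t : T ↦ unitCubeAt t.1 := by
  intro x
  refine ⟨Metric.ball x 1, Metric.ball_mem_nhds x one_pos, ?_⟩
  have hfloor_inj : Function.Injective fun (t : T) j ↦ ⌊t.1 j - x j⌋ := by
    intro s t hst
    by_contra hne
    obtain ⟨j, hj⟩ := h.exists_one_le_abs_sub hne
    refine hj.not_gt ?_
    simpa using Int.abs_sub_lt_one_of_floor_eq_floor (congrFun hst j)
  refine Set.Finite.of_finite_image ?_ hfloor_inj.injOn
  refine (Set.Finite.pi' fun _ ↦ Set.finite_Icc (-2 : ℤ) 0).subset ?_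
  rintro _ ⟨t, ⟨y, hy, hyx⟩, rfl⟩ j
  have hyj := mem_unitCubeAt_iff.mp hy j
  have hyxj : |y j - x j| < 1 :=
    (PiLp.norm_apply_le (y - x) j).trans_lt (mem_ball_iff_norm.mp hyx)
  have := abs_lt.mp hyxj
  exact ⟨Int.le_floor.mpr (by push_cast; linarith),
    Int.lt_add_one_iff.mp (Int.floor_lt.mpr (by push_cast; linarith))⟩

theorem countable (h : IsIntSeparated T) : Countable T :=
  Set.countable_univ_iff.mp <|
    h.locallyFinite_unitCubeAt.countable_univ fun t ↦ ⟨t, by simp [unitCubeAt, unitCube]⟩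

end IsIntSeparated

theorem mem_closure_setOf_forall_lt (x : EuclideanSpace ℝ (Fin d)) :
    x ∈ closure {y : EuclideanSpace ℝ (Fin d) | ∀ j, x j < y j} := by
  have hlim : Filter.Tendsto (fun ε : ℝ ↦ x + ε • WithLp.toLp 2 (1 : Fin d → ℝ))
      (nhdsWithin 0 (Set.Ioi 0)) (nhds x) :=
    (Continuous.tendsto' (by fun_prop) _ _ (by simp)).mono_left nhdsWithin_le_nhds
  refine mem_closure_of_tendsto hlim ?_
  filter_upwards [self_mem_nhdsWithin] with ε hε j
  simpa using hε

theorem mem_unitCubeAt_of_mem_closure {x t : EuclideanSpace ℝ (Fin d)}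
    (hx : x ∈ closure (unitCubeAt t ∩ {y | ∀ j, x j < y j})) : x ∈ unitCubeAt t := by
  refine mem_unitCubeAt_iff.mpr fun j ↦ ⟨?_, ?_⟩
  · have hclosed : IsClosed {y : EuclideanSpace ℝ (Fin d) | t j ≤ y j} :=
      isClosed_le (by fun_prop) (by fun_prop)
    exact closure_minimal (fun y hy ↦ (mem_unitCubeAt_iff.mp hy.1 j).1) hclosed hx
  · obtain ⟨y, hy, hxy⟩ := closure_nonempty_iff.mp ⟨x, hx⟩
    exact (hxy j).trans (mem_unitCubeAt_iff.mp hy j).2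

-- Near `x`, almost every point of the open orthant above `x` is covered, and by finitely many
-- translates; one of them accumulates at `x` from above, hence contains `x`.
theorem IsIntSeparated.isTilingSet_of_ae (h : IsIntSeparated T)
    (hae : ∀ᵐ y : EuclideanSpace ℝ (Fin d), y ∈ ⋃ t : T, unitCubeAt t.1) : IsTilingSet T := by
  refine isTilingSet_iff.mpr fun x ↦ ?_
  set orthant : Set (EuclideanSpace ℝ (Fin d)) := {y | ∀ j, x j < y j} with horthant
  have horthant_open : IsOpen orthant := by
    simp only [horthant, Set.ofPred_forall]
    exact isOpen_iInter_of_finite fun j ↦ isOpen_lt (by fun_prop) (by fun_prop)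
  have hx : x ∈ ⋃ t : T, closure (unitCubeAt t.1 ∩ orthant) := by
    rw [← (h.locallyFinite_unitCubeAt.subset fun t ↦ Set.inter_subset_left).closure_iUnion,
      ← Set.iUnion_inter, Set.inter_comm]
    exact closure_minimal ((Measure.dense_of_ae hae).open_subset_closure_inter horthant_open)
      isClosed_closure (mem_closure_setOf_forall_lt x)
  obtain ⟨t, ht⟩ := Set.mem_iUnion.mp hx
  have hxt := mem_unitCubeAt_of_mem_closure ht
  exact ⟨t, hxt, fun s hxs ↦ h.eq_of_mem_unitCubeAt hxs hxt⟩

end Separation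

section Exponentials

variable {d : ℕ}

/-- Lebesgue measure on the half-open unit cube. -/
noncomputable abbrev cubeMeasure (d : ℕ) : Measure (EuclideanSpace ℝ (Fin d)) :=
  volume.restrict (unitCube d)

theorem toLp_preimage_unitCube :
    WithLp.toLp 2 ⁻¹' unitCube d = Set.univ.pi fun _ ↦ Set.Ico (0 : ℝ) 1 := by
  ext x; simp [unitCube]

theorem measurableSet_unitCube : MeasurableSet (unitCube d) := by
  rw [← (MeasurableEquiv.toLp 2 (Fin d → ℝ)).measurableSet_preimage,
    MeasurableEquiv.coe_toLp, toLp_preimage_unitCube]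
  exact .univ_pi fun _ ↦ measurableSet_Ico

theorem measurePreserving_toLp_cubeMeasure :
    MeasurePreserving (WithLp.toLp 2)
      (Measure.pi fun _ : Fin d ↦ volume.restrict (Set.Ico (0 : ℝ) 1)) (cubeMeasure d) := by
  rw [← Measure.restrict_pi_pi, ← toLp_preimage_unitCube]
  exact (PiLp.volume_preserving_toLp (Fin d)).restrict_preimage measurableSet_unitCube

theorem volume_unitCube : volume (unitCube d) = 1 := by
  rw [← (PiLp.volume_preserving_toLp (Fin d)).measure_preimage
    measurableSet_unitCube.nullMeasurableSet, toLp_preimage_unitCube, volume_pi_pi]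
  simp

instance : IsProbabilityMeasure (cubeMeasure d) := ⟨by simp [volume_unitCube]⟩

theorem norm_expFun (t x : EuclideanSpace ℝ (Fin d)) : ‖expFun t x‖ = 1 := by
  simp [expFun, Complex.norm_exp]

theorem memLp_expFun (t : EuclideanSpace ℝ (Fin d)) : MemLp (expFun t) 2 (cubeMeasure d) :=
  have : Continuous (expFun t) := by unfold expFun; fun_prop
  MemLp.of_bound this.aestronglyMeasurable 1 (.of_forall fun x ↦ (norm_expFun t x).le)

/-- The exponential `e_t` as an element of `L²` of the unit cube. -/
noncomputable def expLp (t : EuclideanSpace ℝ (Fin d)) : Lp ℂ 2 (cubeMeasure d) :=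
  (memLp_expFun t).toLp _

theorem coeFn_expLp (t : EuclideanSpace ℝ (Fin d)) : expLp t =ᵐ[cubeMeasure d] expFun t :=
  (memLp_expFun t).coeFn_toLp

theorem isSpectrum_iff {T : Set (EuclideanSpace ℝ (Fin d))} :
    IsSpectrum T ↔ ∃ b : HilbertBasis T ℂ (Lp ℂ 2 (cubeMeasure d)), ∀ t : T, b t = expLp t.1 := by
  refine exists_congr fun b ↦ forall_congr' fun t ↦ ?_
  exact ⟨fun h ↦ Lp.ext (h.trans (coeFn_expLp _).symm), fun h ↦ h ▸ coeFn_expLp _⟩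

theorem inner_expLp_left (f : Lp ℂ 2 (cubeMeasure d)) (t : EuclideanSpace ℝ (Fin d)) :
    inner ℂ (expLp t) f = ∫ y, f y * conj (expFun t y) ∂cubeMeasure d := by
  rw [L2.inner_def]
  refine integral_congr_ae ?_
  filter_upwards [coeFn_expLp t] with y hy
  rw [hy, RCLike.inner_apply]

theorem inner_expLp_eq_fourier (f : Lp ℂ 2 (cubeMeasure d)) (t : EuclideanSpace ℝ (Fin d)) :
    inner ℂ (expLp t) f = 𝓕 ((unitCube d).indicator f) t := by
  have hexp (y : EuclideanSpace ℝ (Fin d)) :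
      conj (expFun t y) = Complex.exp (↑(-2 * Real.pi * inner ℝ y t) * Complex.I) := by
    rw [expFun, ← Complex.exp_conj, PiLp.inner_apply]
    congr 1
    simp only [Complex.ofReal_sum, Complex.ofReal_mul, map_mul, map_ofNat, map_sum,
      Complex.conj_ofReal, Complex.conj_I, RCLike.inner_apply, Real.ringHom_apply,
      Complex.ofReal_neg, Complex.ofReal_ofNat]
    ring
  rw [inner_expLp_left, Real.fourier_eq', ← integral_indicator measurableSet_unitCube]
  refine integral_congr_ae (.of_forall fun y ↦ ?_)
  by_cases hy : y ∈ unitCube d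
  · simp [hy, hexp, mul_comm]
  · simp [hy]

theorem memLp_indicator_unitCube (f : Lp ℂ 2 (cubeMeasure d)) :
    MemLp ((unitCube d).indicator f) 2 :=
  (memLp_indicator_iff_restrict measurableSet_unitCube).mpr (Lp.memLp f)

theorem integrable_indicator_unitCube (f : Lp ℂ 2 (cubeMeasure d)) :
    Integrable ((unitCube d).indicator f) :=
  (integrable_indicator_iff measurableSet_unitCube).mpr ((Lp.memLp f).integrable one_le_two)

theorem continuous_inner_expLp (f : Lp ℂ 2 (cubeMeasure d)) :
    Continuous fun t ↦ inner ℂ (expLp t) f := by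
  simpa only [inner_expLp_eq_fourier] using continuous_fourier (integrable_indicator_unitCube f)

theorem lintegral_enorm_inner_expLp_sq (f : Lp ℂ 2 (cubeMeasure d)) :
    ∫⁻ t, ‖inner ℂ (expLp t) f‖ₑ ^ 2 = ‖f‖ₑ ^ 2 := by
  simp_rw [inner_expLp_eq_fourier]
  rw [lintegral_enorm_fourier_sq (integrable_indicator_unitCube f) (memLp_indicator_unitCube f),
    enorm_Lp_two_sq, ← lintegral_indicator measurableSet_unitCube]
  refine lintegral_congr fun y ↦ ?_
  by_cases hy : y ∈ unitCube d <;> simp [hy]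

/-- The (inverse) Fourier transform of the indicator function of the unit cube. -/
noncomputable def cubeFourier (x : EuclideanSpace ℝ (Fin d)) : ℂ := ∫ y, expFun x y ∂cubeMeasure d

theorem inner_expLp_expLp (s t : EuclideanSpace ℝ (Fin d)) :
    inner ℂ (expLp s) (expLp t) = cubeFourier (t - s) := by
  have hmul (y : EuclideanSpace ℝ (Fin d)) : expFun t y * conj (expFun s y) = expFun (t - s) y := by
    simp only [expFun, ← Complex.exp_conj, ← Complex.exp_add]
    congr 1
    simp only [Complex.ofReal_sum, Complex.ofReal_mul, Complex.ofReal_sub, map_mul, map_ofNat,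
      map_sum, Complex.conj_ofReal, Complex.conj_I, PiLp.sub_apply, sub_mul, Finset.sum_sub_distrib]
    ring
  rw [inner_expLp_left]
  refine integral_congr_ae ?_
  filter_upwards [coeFn_expLp t] with y hy
  rw [hy, hmul]

theorem norm_expLp (t : EuclideanSpace ℝ (Fin d)) : ‖expLp t‖ = 1 := by
  have hinner : inner ℂ (expLp t) (expLp t) = 1 := by
    rw [inner_expLp_expLp]
    simp [cubeFourier, expFun]
  rw [← sq_eq_sq₀ (norm_nonneg _) zero_le_one, ← inner_self_eq_norm_sq (𝕜 := ℂ), hinner]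
  simp

theorem enorm_expLp (t : EuclideanSpace ℝ (Fin d)) : ‖expLp t‖ₑ = 1 := by
  rw [← ofReal_norm, norm_expLp, ENNReal.ofReal_one]

theorem cubeFourier_eq_inner (x : EuclideanSpace ℝ (Fin d)) :
    cubeFourier x = inner ℂ (expLp (-x)) (expLp 0) := by
  rw [inner_expLp_expLp, zero_sub, neg_neg]

theorem continuous_cubeFourier : Continuous (cubeFourier (d := d)) := by
  simpa only [funext cubeFourier_eq_inner] using!
    (continuous_inner_expLp (expLp 0)).comp continuous_neg

theorem lintegral_enorm_cubeFourier_sq :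
    ∫⁻ x : EuclideanSpace ℝ (Fin d), ‖cubeFourier x‖ₑ ^ 2 = 1 := by
  simp_rw [cubeFourier_eq_inner]
  rw [lintegral_neg_eq_self fun x : EuclideanSpace ℝ (Fin d) ↦ ‖inner ℂ (expLp x) (expLp 0)‖ₑ ^ 2,
    lintegral_enorm_inner_expLp_sq, enorm_expLp, one_pow]

theorem cubeFourier_eq_prod (x : EuclideanSpace ℝ (Fin d)) :
    cubeFourier x = ∏ j, ∫ u in (0 : ℝ)..1, Complex.exp (2 * Real.pi * Complex.I * x j * u) := by
  rw [cubeFourier, ← measurePreserving_toLp_cubeMeasure.integral_comp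
    (MeasurableEquiv.toLp 2 (Fin d → ℝ)).measurableEmbedding]
  simp only [intervalIntegral.integral_of_le zero_le_one, ← integral_Ico_eq_integral_Ioc]
  rw [← integral_fintype_prod_eq_prod (𝕜 := ℂ)]
  congr 1 with y
  rw [expFun, ← Complex.exp_sum]
  push_cast
  simp only [Finset.mul_sum, mul_assoc]

theorem integral_exp_two_pi_mul_I_eq_zero_iff (a : ℝ) :
    ∫ u in (0 : ℝ)..1, Complex.exp (2 * Real.pi * Complex.I * a * u) = 0 ↔
      ∃ n : ℤ, n ≠ 0 ∧ a = n := by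
  obtain rfl | ha := eq_or_ne a 0
  · simp [eq_comm (a := (0 : ℝ))]
  have hpi : (2 * Real.pi * Complex.I : ℂ) ≠ 0 := Complex.two_pi_I_ne_zero
  have hc : 2 * Real.pi * Complex.I * a ≠ 0 := mul_ne_zero hpi (by exact_mod_cast ha)
  rw [integral_exp_mul_complex hc, div_eq_zero_iff, or_iff_left hc, sub_eq_zero,
    Complex.ofReal_zero, mul_zero, Complex.exp_zero, Complex.ofReal_one, mul_one,
    Complex.exp_eq_one_iff]
  refine exists_congr fun n ↦ ?_
  rw [mul_comm (n : ℂ), mul_right_inj' hpi]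
  norm_cast
  exact (and_iff_right_of_imp fun h ↦ by rintro rfl; exact ha (by simpa using h)).symm

theorem cubeFourier_eq_zero_iff (x : EuclideanSpace ℝ (Fin d)) :
    cubeFourier x = 0 ↔ ∃ j, ∃ n : ℤ, n ≠ 0 ∧ x j = n := by
  simp [cubeFourier_eq_prod, Finset.prod_eq_zero_iff, integral_exp_two_pi_mul_I_eq_zero_iff]

theorem orthonormal_expLp_iff {T : Set (EuclideanSpace ℝ (Fin d))} :
    Orthonormal ℂ (fun t : T ↦ expLp t.1) ↔ IsIntSeparated T := by
  have hpair (s t : EuclideanSpace ℝ (Fin d)) :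
      inner ℂ (expLp t) (expLp s) = 0 ↔ ∃ j, ∃ n : ℤ, n ≠ 0 ∧ s j - t j = n := by
    rw [inner_expLp_expLp, cubeFourier_eq_zero_iff]
    rfl
  refine ⟨fun h s hs t ht hst ↦ ?_, fun h ↦ ⟨fun t ↦ norm_expLp t.1, fun s t hst ↦ ?_⟩⟩
  · exact (hpair s t).mp (h.2 (i := ⟨t, ht⟩) (j := ⟨s, hs⟩) (by simpa using hst.symm))
  · exact (hpair t s).mpr (h t.2 s.2 (Subtype.coe_ne_coe.mpr hst.symm))

theorem IsSpectrum.isIntSeparated {T : Set (EuclideanSpace ℝ (Fin d))} (h : IsSpectrum T) :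
    IsIntSeparated T := by
  obtain ⟨b, hb⟩ := isSpectrum_iff.mp h
  exact orthonormal_expLp_iff.mp (funext hb ▸ b.orthonormal)

theorem isSpectrum_of_orthonormal {T : Set (EuclideanSpace ℝ (Fin d))}
    (horth : Orthonormal ℂ fun t : T ↦ expLp t.1)
    (htotal : ∀ f : Lp ℂ 2 (cubeMeasure d), (∀ t : T, inner ℂ (expLp t.1) f = 0) → f = 0) :
    IsSpectrum T := by
  refine isSpectrum_iff.mpr ⟨HilbertBasis.mkOfOrthogonalEqBot horth ?_,
    fun t ↦ by rw [HilbertBasis.coe_mkOfOrthogonalEqBot]⟩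
  refine (Submodule.eq_bot_iff _).mpr fun f hf ↦ htotal f fun t ↦ ?_
  exact (Submodule.mem_orthogonal _ _).mp hf _ (Submodule.subset_span ⟨t, rfl⟩)

end Exponentials

section Duality

variable {d : ℕ} {T : Set (EuclideanSpace ℝ (Fin d))}

theorem lintegral_indicator_unitCube :
    ∫⁻ x : EuclideanSpace ℝ (Fin d), (unitCube d).indicator 1 x = 1 := by
  rw [lintegral_indicator_one measurableSet_unitCube, volume_unitCube]

theorem measurable_enorm_cubeFourier_sq :
    Measurable fun x : EuclideanSpace ℝ (Fin d) ↦ ‖cubeFourier x‖ₑ ^ 2 :=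
  continuous_cubeFourier.enorm.measurable.pow_const 2

theorem IsIntSeparated.tsum_indicator_unitCube_le_one (h : IsIntSeparated T)
    (x : EuclideanSpace ℝ (Fin d)) :
    ∑' t : T, (unitCube d).indicator (1 : EuclideanSpace ℝ (Fin d) → ℝ≥0∞) (x - t) ≤ 1 := by
  rw [h.tsum_indicator_unitCube]
  exact Set.indicator_le_self' (fun _ _ ↦ zero_le_one) x

theorem IsTilingSet.tsum_indicator_unitCube_eq_one (h : IsTilingSet T)
    (x : EuclideanSpace ℝ (Fin d)) :
    ∑' t : T, (unitCube d).indicator (1 : EuclideanSpace ℝ (Fin d) → ℝ≥0∞) (x - t) = 1 := by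
  obtain ⟨t, ht⟩ := (isTilingSet_iff.mp h x).exists
  rw [h.isIntSeparated.tsum_indicator_unitCube,
    Set.indicator_of_mem (Set.mem_iUnion_of_mem t ht), Pi.one_apply]

theorem IsIntSeparated.tsum_enorm_cubeFourier_sq_le_one (h : IsIntSeparated T)
    (x : EuclideanSpace ℝ (Fin d)) : ∑' t : T, ‖cubeFourier (x - t.1)‖ₑ ^ 2 ≤ 1 := by
  simpa only [inner_expLp_expLp, enorm_expLp, one_pow] using
    tsum_enorm_inner_sq_le (orthonormal_expLp_iff.mpr h) (expLp x)

theorem IsSpectrum.tsum_enorm_cubeFourier_sq_eq_one (h : IsSpectrum T)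
    (x : EuclideanSpace ℝ (Fin d)) : ∑' t : T, ‖cubeFourier (x - t.1)‖ₑ ^ 2 = 1 := by
  obtain ⟨b, hb⟩ := isSpectrum_iff.mp h
  simpa only [hb, inner_expLp_expLp, enorm_expLp, one_pow] using tsum_enorm_inner_sq_eq b (expLp x)

theorem IsSpectrum.isTilingSet (h : IsSpectrum T) : IsTilingSet T := by
  have hsep := h.isIntSeparated
  have := hsep.countable
  have hcube : ∀ᵐ x : EuclideanSpace ℝ (Fin d),
      ∑' t : T, (unitCube d).indicator (1 : EuclideanSpace ℝ (Fin d) → ℝ≥0∞) (x - t) = 1 :=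
    tsum_sub_ae_eq_one_of_lintegral_eq measurable_enorm_cubeFourier_sq
      (measurable_one.indicator measurableSet_unitCube)
      (lintegral_enorm_cubeFourier_sq.trans lintegral_indicator_unitCube.symm)
      (by simp [lintegral_enorm_cubeFourier_sq]) (by simp [lintegral_enorm_cubeFourier_sq])
      (.of_forall h.tsum_enorm_cubeFourier_sq_eq_one)
      (.of_forall hsep.tsum_indicator_unitCube_le_one)
  refine hsep.isTilingSet_of_ae ?_
  filter_upwards [hcube] with x hx
  by_contra hxt
  rw [hsep.tsum_indicator_unitCube, Set.indicator_of_notMem hxt] at hx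
  exact zero_ne_one hx

theorem IsTilingSet.isSpectrum (h : IsTilingSet T) : IsSpectrum T := by
  have hsep := h.isIntSeparated
  have := hsep.countable
  have horth := orthonormal_expLp_iff.mpr hsep
  have hfourier : ∀ᵐ x : EuclideanSpace ℝ (Fin d), ∑' t : T, ‖cubeFourier (x - t.1)‖ₑ ^ 2 = 1 :=
    tsum_sub_ae_eq_one_of_lintegral_eq (measurable_one.indicator measurableSet_unitCube)
      measurable_enorm_cubeFourier_sq
      (lintegral_indicator_unitCube.trans lintegral_enorm_cubeFourier_sq.symm)
      (by simp [lintegral_indicator_unitCube]) (by simp [lintegral_indicator_unitCube])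
      (.of_forall h.tsum_indicator_unitCube_eq_one)
      (.of_forall hsep.tsum_enorm_cubeFourier_sq_le_one)
  refine isSpectrum_of_orthonormal horth fun f hf ↦ ?_
  have hinner : ∀ᵐ x : EuclideanSpace ℝ (Fin d), inner ℂ (expLp x) f = 0 := by
    filter_upwards [hfourier] with x hx
    refine inner_eq_zero_of_tsum_enorm_inner_sq_eq horth ?_ hf
    simpa only [inner_expLp_expLp, enorm_expLp, one_pow] using hx
  have hnorm : ‖f‖ₑ ^ 2 = 0 := by
    rw [← lintegral_enorm_inner_expLp_sq f]
    exact (lintegral_congr_ae (hinner.mono fun x hx ↦ by simp [hx])).trans lintegral_zero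
  exact enorm_eq_zero.mp (eq_zero_of_pow_eq_zero hnorm)

end Duality

theorem theorem1p1 (d : ℕ) (T : Set (EuclideanSpace ℝ (Fin d))) :
    IsSpectrum T ↔ IsTilingSet T :=
  ⟨IsSpectrum.isTilingSet, IsTilingSet.isSpectrum⟩
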